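/- Let $n\ge 2$ and let $A=(a_{i,j})\in\mathbb R^{n\times n}$ be an irreducible L-matrix with unit diagonal, i.e. $a_{i,i}=1$ for all $i$, $a_{i,j}\le 0$ for $i\ne j$, and no simultaneous permutation of rows and columns brings $A$ to block upper triangular form $\begin{pmatrix}B_{1,1}&B_{1,2}\\0&B_{2,2}\end{pmatrix}$ with square diagonal blocks of sizes $k$ and $n-k$, $1\le k\le n-1$. Let $0<\omega\le 1$ and $0\le\gamma\le 1$. For a matrix $B=D-L-U$, with $D$ diagonal, $L$ strictly lower triangular and $U$ strictly upper triangular, let $$\mathscr L_{\gamma,\omega}(B)=(D-\gamma L)^{-1}\left[(1-\omega)D+(\omega-\gamma)L+\omega U\right]$$ be its AOR iteration matrix, and let $\rho$ denote the spectral radius. Fix $2\le r\le n$ and $\alpha_r,\dots,\alpha_n\ge 0$ with $\sum_{k=r}^n\alpha_k a_{k,r-1}\ne 0$. Let $Q_6$ be the $n\times n$ matrix whose $(i,r-1)$ entry is $-\alpha_i a_{i,r-1}$ for $i=r,\dots,n$ and whose other entries are $0$, and put $A^{(6)}=(I+Q_6)A$. Assume that $\alpha_k a_{k,r-1}a_{r-1,k}<1$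 for $k=r,\dots,n$. Write $(\ast)$ for the condition: $0\le\alpha_k\le 1$ for $k=r,\dots,n$, and either $A^{(6)}$ is irreducible or $\alpha_k<1$ for all $k=r,\dots,n$. Suppose that one of the following conditions is satisfied: (i) $0\le\gamma<1$ and $(\ast)$ holds. (ii) $\gamma=1$, $(\ast)$ holds, and one of the following holds: (ii$_1$) there exist $i\in\{r,\dots,n\}$ and $j\in\{r,\dots,i\}$ such that $\alpha_i a_{i,r-1}a_{r-1,j}>0$; (ii$_2$) $a_{r-1,r}<0$; (ii$_3$) $r=2$, $a_{n,1}<0$ and $\alpha_n>0$. (iii) $r=2$, $0\le\gamma<1$ and $0<\alpha_k\le 1$ for $k=2,\dots,n$. (iv) $r=2$, $\gamma=1$, $0<\alpha_k\le 1$ for $k=2,\dots,n$, and one of the following holds: (iv$_1$) there exist $i\in\{2,\dots,n\}$ and $j\in\{2,\dots,i\}$ such that $a_{i,1}a_{1,j}>0$; (iv$_2$) $a_{1,2}<0$; (iv$_3$) $a_{n,1}<0$. Then exactly one of the following relations holds: (a) $\rho(\mathscr L_{\gamma,\omega}(A^{(6)}))<\rho(\mathscr L_{\gamma,\omega}(A))<1$;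 (b) $\rho(\mathscr L_{\gamma,\omega}(A^{(6)}))=\rho(\mathscr L_{\gamma,\omega}(A))=1$; (c) $\rho(\mathscr L_{\gamma,\omega}(A^{(6)}))>\rho(\mathscr L_{\gamma,\omega}(A))>1$. -/

import Mathlib

/-! Indices are `0`-based: the `1`-based index `k ∈ {1, …, n}` is the element of `Fin n` with
value `k - 1`. -/

namespace AOR

noncomputable section

variable {n : ℕ}

/-- `B` is a Z-matrix: its off-diagonal entries are nonpositive. -/
def IsZMatrix (B : Matrix (Fin n) (Fin n) ℝ) : Prop :=
  ∀ i j, i ≠ j → B i j ≤ 0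

/-- `B` is an L-matrix: a Z-matrix with positive diagonal entries. -/
def IsLMatrix (B : Matrix (Fin n) (Fin n) ℝ) : Prop :=
  IsZMatrix B ∧ ∀ i, 0 < B i i

/-- `B` is reducible: for some permutation `σ` of the indices and some `1 ≤ k ≤ n - 1`, the
simultaneously permuted matrix has a zero lower left block of size `(n - k) × k`. -/
def IsReducible (B : Matrix (Fin n) (Fin n) ℝ) : Prop :=
  ∃ (σ : Equiv.Perm (Fin n)) (k : ℕ), 1 ≤ k ∧ k < n ∧
    ∀ i j : Fin n, k ≤ (i : ℕ) → (j : ℕ) < k → B.submatrix σ σ i j = 0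

/-- `B` is irreducible if it is not reducible. -/
def IsIrreducible (B : Matrix (Fin n) (Fin n) ℝ) : Prop :=
  ¬ IsReducible B

/-- The diagonal part `D` in `B = D - L - U`. -/
def diagPart (B : Matrix (Fin n) (Fin n) ℝ) : Matrix (Fin n) (Fin n) ℝ :=
  Matrix.diagonal fun i => B i i

/-- The strictly lower triangular matrix `L` in `B = D - L - U`. -/
def lowerPart (B : Matrix (Fin n) (Fin n) ℝ) : Matrix (Fin n) (Fin n) ℝ :=
  Matrix.of fun i j => if j < i then -B i j else 0

/-- The strictly upper triangular matrix `U` in `B = D - L - U`. -/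
def upperPart (B : Matrix (Fin n) (Fin n) ℝ) : Matrix (Fin n) (Fin n) ℝ :=
  Matrix.of fun i j => if i < j then -B i j else 0

/-- The AOR iteration matrix
`(D - γ L)⁻¹ [(1 - ω) D + (ω - γ) L + ω U]` of `B = D - L - U`. -/
def iterMatrix (B : Matrix (Fin n) (Fin n) ℝ) (γ ω : ℝ) : Matrix (Fin n) (Fin n) ℝ :=
  (diagPart B - γ • lowerPart B)⁻¹ *
    ((1 - ω) • diagPart B + (ω - γ) • lowerPart B + ω • upperPart B)

/-- The spectral radius of a real matrix: the largest modulus of its complex eigenvalues. -/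
def rho (B : Matrix (Fin n) (Fin n) ℝ) : ENNReal :=
  spectralRadius ℂ (B.map Complex.ofReal)

/-- The matrix whose only nonzero entries are `-α i * A i p`, in column `p` and rows `i > p`.
In `1`-based notation `p` is the column `r - 1` and the rows are `r, …, n`. -/
def Q6 (A : Matrix (Fin n) (Fin n) ℝ) (p : Fin n) (α : Fin n → ℝ) :
    Matrix (Fin n) (Fin n) ℝ :=
  Matrix.of fun i j => if j = p ∧ p < i then -(α i * A i p) else 0

/-- The preconditioned matrix `(I + Q₆) A`. -/
def A6 (A : Matrix (Fin n) (Fin n) ℝ) (p : Fin n) (α : Fin n → ℝ) :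
    Matrix (Fin n) (Fin n) ℝ :=
  (1 + Q6 A p α) * A

/-- The condition `0 ≤ α_k ≲ 1`, `k = r, …, n`: the upper bound is `α_k ≤ 1` if the
preconditioned matrix is irreducible, and `α_k < 1` otherwise. -/
def LesssimOne (A : Matrix (Fin n) (Fin n) ℝ) (p : Fin n) (α : Fin n → ℝ) : Prop :=
  ∀ k, p < k → 0 ≤ α k ∧ (α k < 1 ∨ (α k ≤ 1 ∧ IsIrreducible (A6 A p α)))

/-- Exactly one of three propositions holds. -/
def ExactlyOne (a b c : Prop) : Prop :=
  (a ∨ b ∨ c) ∧ ¬ (a ∧ b) ∧ ¬ (a ∧ c) ∧ ¬ (b ∧ c)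

/-- The strict Stein–Rosenberg type alternative between the AOR iteration matrices of the
preconditioned matrix `B` and of `A`. -/
def SteinRosenbergII (B A : Matrix (Fin n) (Fin n) ℝ) (γ ω : ℝ) : Prop :=
  ExactlyOne
    (rho (iterMatrix B γ ω) < rho (iterMatrix A γ ω) ∧ rho (iterMatrix A γ ω) < 1)
    (rho (iterMatrix B γ ω) = rho (iterMatrix A γ ω) ∧ rho (iterMatrix A γ ω) = 1)
    (rho (iterMatrix B γ ω) > rho (iterMatrix A γ ω) ∧ rho (iterMatrix A γ ω) > 1)

end

end AOR

/-! Split `A = M - N` with `M = D - γL`, `N = (1-γ)L + U`. The AOR matrix is `(1-ω)I + ω M⁻¹N` with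
`M⁻¹N ≥ 0`, so its spectral radius is `1 - ω + ωr`, where `r` is the Perron root of `M⁻¹N`; only the
roots `r` of `A` and `r'` of `A' = PA`, `P = I + Q₆`, need comparing.

Pair a right Perron vector `Nx = rMx` of `A` with a left one `zN' = r'zM'` of `A'`. Evaluating
`zA'x` in two ways gives `(r' - r)(zM'x) = (1 - r) zEx` with `E = M' - PM`
(`eigenvalue_sub_mul_eq`). Irreducibility of `A` gives `x > 0`, hence `zM'x > 0`, and `E ≤ 0`
entrywise. If `zEx < 0`, then `r' - r` and `r - 1` have the same sign, which is the trichotomy.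

Strictness needs a negative entry of `E` in some row `i > p` (`exists_splitM_A6_sub_neg`) and `z i >
0` there. The latter needs only that edge-closed sets of `A'` contain all indices beyond `p`, so
`A'` may be reducible. The argument for `z` fails only when `γ = 1` and `r' = 0`; there `r > 0`
settles the comparison directly. -/

namespace AOR

open Matrix Filter Topology

/-! ### Perron–Frobenius theory via Collatz–Wielandt bounds -/

section PerronFrobenius

variable {ι : Type*} [Fintype ι]

/-- `r` bounds every `t` with `t v ≤ B v` for some nonzero `v ≥ 0`. -/
def IsCollatzWielandtBound (B : Matrix ι ι ℝ) (r : ℝ) : Prop :=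
  ∀ (v : ι → ℝ) (t : ℝ), (∀ i, 0 ≤ v i) → v ≠ 0 → (∀ i, t * v i ≤ (B *ᵥ v) i) → t ≤ r

theorem mulVec_nonneg_of_nonneg {κ : Type*} {B : Matrix κ ι ℝ} (hB : ∀ i j, 0 ≤ B i j)
    {v : ι → ℝ} (hv : ∀ i, 0 ≤ v i) (i : κ) : 0 ≤ (B *ᵥ v) i :=
  Finset.sum_nonneg fun j _ => mul_nonneg (hB i j) (hv j)

theorem mulVec_pos_of_pos {B : Matrix ι ι ℝ} (hB : ∀ i j, 0 < B i j)
    {v : ι → ℝ} (hv : ∀ i, 0 ≤ v i) (hv0 : v ≠ 0) (i : ι) : 0 < (B *ᵥ v) i := by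
  obtain ⟨j, hj⟩ := Function.ne_iff.mp hv0
  exact Finset.sum_pos' (fun j _ => mul_nonneg (hB i j).le (hv j))
    ⟨j, Finset.mem_univ _, mul_pos (hB i j) (lt_of_le_of_ne (hv j) (Ne.symm hj))⟩

theorem stdSimplex_ne_zero {x : ι → ℝ} (hx : x ∈ stdSimplex ℝ ι) : x ≠ 0 := by
  rintro rfl
  simpa using hx.2

theorem exists_smul_mem_stdSimplex {v : ι → ℝ} (hv : ∀ i, 0 ≤ v i) (hv0 : v ≠ 0) :
    ∃ c : ℝ, 0 < c ∧ c • v ∈ stdSimplex ℝ ι := by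
  obtain ⟨j, hj⟩ := Function.ne_iff.mp hv0
  have hs : 0 < ∑ i, v i := Finset.sum_pos' (fun i _ => hv i)
    ⟨j, Finset.mem_univ _, lt_of_le_of_ne (hv j) (Ne.symm hj)⟩
  refine ⟨(∑ i, v i)⁻¹, inv_pos.mpr hs, fun i => ?_, ?_⟩
  · exact mul_nonneg (inv_pos.mpr hs).le (hv i)
  · simp only [Pi.smul_apply, smul_eq_mul, ← Finset.mul_sum]
    exact inv_mul_cancel₀ hs.ne'

/-- Perron's theorem for positive matrices. -/
theorem exists_perron_of_pos [Nonempty ι] {B : Matrix ι ι ℝ} (hB : ∀ i j, 0 < B i j) :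
    ∃ (r : ℝ) (x : ι → ℝ), x ∈ stdSimplex ℝ ι ∧ B *ᵥ x = r • x ∧
      IsCollatzWielandtBound B r := by
  classical
  set C := ∑ i, ∑ j, B i j with hC
  have hC0 : 0 ≤ C := Finset.sum_nonneg fun i _ => Finset.sum_nonneg fun j _ => (hB i j).le
  have hcont : Continuous fun q : ℝ × (ι → ℝ) => B *ᵥ q.2 := by fun_prop
  -- The root is the largest `t` with `t v ≤ B v` on the simplex. Summing coordinates bounds `t` by
  -- the total `C` of all entries, which makes the set compact.
  let K : Set (ℝ × (ι → ℝ)) := (Set.Icc 0 C ×ˢ stdSimplex ℝ ι) ∩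
    {q | ∀ i, q.1 * q.2 i ≤ (B *ᵥ q.2) i}
  have hK : IsCompact K := by
    refine (isCompact_Icc.prod (isCompact_stdSimplex ℝ ι)).inter_right ?_
    rw [Set.ofPred_forall]
    refine isClosed_iInter fun i => isClosed_le (by fun_prop) ?_
    exact (continuous_apply i).comp hcont
  have hKne : K.Nonempty := by
    obtain ⟨i⟩ := ‹Nonempty ι›
    have hs := single_mem_stdSimplex ℝ i
    refine ⟨(0, Pi.single i 1), ⟨⟨le_rfl, hC0⟩, hs⟩, fun j => ?_⟩
    simpa using mulVec_nonneg_of_nonneg (fun i j => (hB i j).le) hs.1 j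
  obtain ⟨⟨r, x⟩, ⟨⟨hr, hx⟩, hrx⟩, hmax⟩ := hK.exists_isMaxOn hKne continuous_fst.continuousOn
  simp only at hr hx hrx
  have hbound : IsCollatzWielandtBound B r := by
    intro v t hv hv0 hle
    rcases lt_or_ge t 0 with ht | ht
    · exact ht.le.trans hr.1
    obtain ⟨c, hc, hcv⟩ := exists_smul_mem_stdSimplex hv hv0
    have hle' : ∀ i, t * (c • v) i ≤ (B *ᵥ (c • v)) i := fun i => by
      rw [mulVec_smul, Pi.smul_apply, Pi.smul_apply, smul_eq_mul, smul_eq_mul, mul_left_comm]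
      exact mul_le_mul_of_nonneg_left (hle i) hc.le
    have htC : t ≤ C := by
      calc t = ∑ i, t * (c • v) i := by rw [← Finset.mul_sum, hcv.2, mul_one]
        _ ≤ ∑ i, (B *ᵥ (c • v)) i := Finset.sum_le_sum fun i _ => hle' i
        _ ≤ C := Finset.sum_le_sum fun i _ => Finset.sum_le_sum fun j _ =>
            mul_le_of_le_one_right (hB i j).le
              ((Finset.single_le_sum (fun k _ => hcv.1 k) (Finset.mem_univ j)).trans_eq hcv.2)
    exact hmax (show (t, c • v) ∈ K from ⟨⟨⟨ht, htC⟩, hcv⟩, hle'⟩)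
  refine ⟨r, x, hx, ?_, hbound⟩
  -- If the slack `y - r x` is nonzero, positivity of `B` makes `B (y - r x)` strictly positive, so
  -- `y` admits a constant `r + ε`, against maximality.
  by_contra hne
  set y := B *ᵥ x with hy
  have hy0 : ∀ i, 0 < y i := mulVec_pos_of_pos hB hx.1 (stdSimplex_ne_zero hx)
  have hw : ∀ i, 0 < (B *ᵥ (y - r • x)) i :=
    mulVec_pos_of_pos hB (fun i => by simpa using hrx i) (sub_ne_zero.mpr hne)
  obtain ⟨i₀, -, hi₀⟩ := Finset.exists_min_image Finset.univ
    (fun i => (B *ᵥ (y - r • x)) i / y i) Finset.univ_nonempty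
  set ε := (B *ᵥ (y - r • x)) i₀ / y i₀ with hε
  have hε0 : 0 < ε := div_pos (hw i₀) (hy0 i₀)
  have : r + ε ≤ r := by
    refine hbound y (r + ε) (fun i => (hy0 i).le) (fun h => ?_) fun i => ?_
    · simpa [h] using hy0 i₀
    · have h1 := (le_div_iff₀ (hy0 i)).mp (hi₀ i (Finset.mem_univ i))
      rw [mulVec_sub, mulVec_smul, ← hy] at h1
      simp only [Pi.sub_apply, Pi.smul_apply, smul_eq_mul] at h1
      rw [mulVec_sub, mulVec_smul, ← hy] at hε
      linarith
  linarith

/-- The weak Perron–Frobenius theorem for nonnegative matrices. -/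
theorem exists_perron_of_nonneg [Nonempty ι] {B : Matrix ι ι ℝ} (hB : ∀ i j, 0 ≤ B i j) :
    ∃ (r : ℝ) (x : ι → ℝ), 0 ≤ r ∧ (∀ i, 0 ≤ x i) ∧ x ≠ 0 ∧ B *ᵥ x = r • x ∧
      IsCollatzWielandtBound B r := by
  classical
  let P : ℕ → Matrix ι ι ℝ := fun k => B + Matrix.of fun _ _ => 1 / ((k : ℝ) + 1)
  have hPpos : ∀ k i j, 0 < P k i j := fun k i j =>
    add_pos_of_nonneg_of_pos (hB i j) (by simp only [of_apply]; positivity)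
  have hBP : ∀ k i j, B i j ≤ P k i j := fun k i j =>
    le_add_of_nonneg_right (by simp only [of_apply]; positivity)
  choose r x hx hrx hb using fun k => exists_perron_of_pos (hPpos k)
  obtain ⟨x₀, hx₀, φ, hφ, hlim⟩ := (isCompact_stdSimplex ℝ ι).tendsto_subseq hx
  have hP : ∀ i j, Tendsto (fun k => P (φ k) i j) atTop (𝓝 (B i j)) := fun i j => by
    have := (tendsto_one_div_add_atTop_nhds_zero_nat (𝕜 := ℝ)).comp hφ.tendsto_atTop
    simpa [P] using this.const_add (B i j)
  have hPx : Tendsto (fun k => P (φ k) *ᵥ x (φ k)) atTop (𝓝 (B *ᵥ x₀)) :=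
    tendsto_pi_nhds.mpr fun i => tendsto_finsetSum _ fun j _ =>
      (hP i j).mul (tendsto_pi_nhds.mp hlim j)
  -- On the simplex the root is the coordinate sum of `P x`, so convergence of the vectors forces
  -- convergence of the roots.
  have hreq : ∀ k, r k = ∑ i, (P k *ᵥ x k) i := fun k => by
    rw [hrx k]
    simp only [Pi.smul_apply, smul_eq_mul, ← Finset.mul_sum, (hx k).2, mul_one]
  have hr : Tendsto (fun k => r (φ k)) atTop (𝓝 (∑ i, (B *ᵥ x₀) i)) := by
    simp only [hreq]
    exact tendsto_finsetSum _ fun i _ => tendsto_pi_nhds.mp hPx i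
  refine ⟨∑ i, (B *ᵥ x₀) i, x₀,
    Finset.sum_nonneg fun i _ => mulVec_nonneg_of_nonneg hB hx₀.1 i, hx₀.1,
    stdSimplex_ne_zero hx₀, ?_, ?_⟩
  · refine tendsto_nhds_unique hPx ?_
    simp only [hrx]
    exact hr.smul hlim
  · intro v t hv hv0 hle
    refine ge_of_tendsto' hr fun k => hb _ v t hv hv0 fun i => (hle i).trans ?_
    exact Finset.sum_le_sum fun j _ => mul_le_mul_of_nonneg_right (hBP _ i j) (hv j)

end PerronFrobenius

/-! ### Spectral radius and Perron root -/

section SpectralRadius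

variable {n : ℕ}

theorem rho_transpose (B : Matrix (Fin n) (Fin n) ℝ) : rho Bᵀ = rho B := by
  have : spectrum ℂ (Bᵀ.map Complex.ofReal) = spectrum ℂ (B.map Complex.ofReal) := by
    ext z
    rw [Matrix.mem_spectrum_iff_isRoot_charpoly, Matrix.mem_spectrum_iff_isRoot_charpoly,
      transpose_map, charpoly_transpose]
  simp only [rho, spectralRadius, this]

theorem mem_spectrum_iff_exists_mulVec {B : Matrix (Fin n) (Fin n) ℂ} {z : ℂ} :
    z ∈ spectrum ℂ B ↔ ∃ v ≠ 0, B *ᵥ v = z • v := by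
  rw [← spectrum_toLin', ← Module.End.hasEigenvalue_iff_mem_spectrum]
  constructor
  · intro h
    obtain ⟨v, hv⟩ := h.exists_hasEigenvector
    exact ⟨v, hv.2, by simpa using hv.apply_eq_smul⟩
  · rintro ⟨v, hv0, hv⟩
    exact Module.End.hasEigenvalue_of_hasEigenvector
      (x := v) ⟨Module.End.mem_eigenspace_iff.mpr (by simpa using hv), hv0⟩

/-- The spectral radius of `c + ω T` for nonnegative `T` with Perron root `r`. -/
theorem rho_add_smul_eq {T : Matrix (Fin n) (Fin n) ℝ} (hT : ∀ i j, 0 ≤ T i j) {r : ℝ}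
    {x : Fin n → ℝ} (hx0 : x ≠ 0) (hx : T *ᵥ x = r • x)
    (hb : IsCollatzWielandtBound T r) {c ω : ℝ} (hc : 0 ≤ c) (hω : 0 < ω) :
    rho (c • 1 + ω • T) = ENNReal.ofReal (c + ω * r) := by
  have hmap : (c • (1 : Matrix (Fin n) (Fin n) ℝ) + ω • T).map Complex.ofReal =
      (c : ℂ) • 1 + (ω : ℂ) • T.map Complex.ofReal := by
    ext i j
    simp [Matrix.one_apply, apply_ite Complex.ofReal]
  have hW : ∀ v : Fin n → ℂ, (c • (1 : Matrix (Fin n) (Fin n) ℝ) + ω • T).map Complex.ofReal *ᵥ v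
      = (c : ℂ) • v + (ω : ℂ) • (T.map Complex.ofReal *ᵥ v) := fun v => by
    rw [hmap, add_mulVec, smul_mulVec, smul_mulVec, one_mulVec]
  apply le_antisymm
  · refine iSup₂_le fun z hz => ?_
    obtain ⟨v, hv0, hv⟩ := mem_spectrum_iff_exists_mulVec.mp hz
    rw [hW] at hv
    -- The vector of moduli of a complex eigenvector is a Collatz–Wielandt test vector, by the
    -- triangle inequality.
    have key : (‖z‖ - c) / ω ≤ r := by
      refine hb (fun i => ‖v i‖) _ (fun i => norm_nonneg _)
        (fun h => hv0 (funext fun i => norm_eq_zero.mp (congrFun h i))) fun i => ?_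
      have hvi := congrFun hv i
      simp only [Pi.add_apply, Pi.smul_apply, smul_eq_mul] at hvi
      have h1 : ‖(T.map Complex.ofReal *ᵥ v) i‖ ≤ (T *ᵥ fun i => ‖v i‖) i := by
        refine (norm_sum_le Finset.univ fun j => T.map Complex.ofReal i j * v j).trans_eq
          (Finset.sum_congr rfl fun j _ => ?_)
        simp [abs_of_nonneg (hT i j)]
      have h2 : ‖z‖ * ‖v i‖ ≤ c * ‖v i‖ + ω * ‖(T.map Complex.ofReal *ᵥ v) i‖ := by
        rw [← norm_mul, ← hvi]
        refine (norm_add_le _ _).trans_eq ?_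
        simp [abs_of_nonneg hc, abs_of_pos hω]
      rw [div_mul_eq_mul_div, div_le_iff₀ hω]
      nlinarith
    rw [div_le_iff₀ hω] at key
    rw [← enorm_eq_nnnorm, ← ofReal_norm]
    exact ENNReal.ofReal_le_ofReal (by linarith)
  · have hmem : ((c + ω * r : ℝ) : ℂ) ∈
        spectrum ℂ ((c • (1 : Matrix (Fin n) (Fin n) ℝ) + ω • T).map Complex.ofReal) := by
      refine mem_spectrum_iff_exists_mulVec.mpr ⟨fun i => (x i : ℂ), fun h => hx0 ?_, ?_⟩
      · exact funext fun i => Complex.ofReal_eq_zero.mp (congrFun h i)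
      · rw [hW]
        have : (T.map Complex.ofReal *ᵥ fun i => (x i : ℂ)) = fun i => ((r * x i : ℝ) : ℂ) := by
          funext i
          have := congrFun hx i
          simp only [mulVec, dotProduct, Pi.smul_apply, smul_eq_mul] at this
          rw [← this]
          simp [mulVec, dotProduct]
        rw [this]
        funext i
        simp
        ring
    refine le_trans ?_ (le_iSup₂ (f := fun (k : ℂ) (_ : k ∈ spectrum ℂ _) => (‖k‖₊ : ENNReal)) _ hmem)
    rw [← enorm_eq_nnnorm, ← ofReal_norm, Complex.norm_real, Real.norm_eq_abs]
    exact ENNReal.ofReal_le_ofReal (le_abs_self _)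

end SpectralRadius

end AOR

namespace AOR

open Matrix

variable {n : ℕ}

/-! ### Irreducibility through closed index sets -/

section Irreducible

/-- In an irreducible matrix, the only nonempty set of indices closed under the edges `i → j` with
`B i j ≠ 0` is the full one. -/
theorem IsIrreducible.mem_of_closed {B : Matrix (Fin n) (Fin n) ℝ} (hB : IsIrreducible B)
    {s : Set (Fin n)} (hs : s.Nonempty) (hc : ∀ i ∈ s, ∀ j, i ≠ j → B i j ≠ 0 → j ∈ s)
    (j : Fin n) : j ∈ s := by
  classical
  by_contra hj
  apply hB
  obtain ⟨i, hi⟩ := hs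
  set k := Fintype.card {x : Fin n // x ∉ s} with hk
  have hk0 : 0 < k := Fintype.card_pos_iff.mpr ⟨⟨j, hj⟩⟩
  have hkn : k < n := by
    have := Fintype.card_subtype_lt (p := fun x : Fin n => x ∉ s) (x := i) (by simpa using hi)
    rwa [Fintype.card_fin] at this
  have hcard : Fintype.card {x : Fin n // (x : ℕ) < k} = k := by
    rw [Fintype.card_subtype]
    rw [Fin.card_filter_val_lt, min_eq_right hkn.le]
  let e : {x : Fin n // (x : ℕ) < k} ≃ {x : Fin n // x ∉ s} :=
    Fintype.equivOfCardEq (hcard.trans hk)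
  -- The permutation lists the complement of `s` first, so the lower left block consists of entries
  -- from `s` to its complement.
  refine ⟨e.extendSubtype, k, hk0, hkn, fun a b ha hb => ?_⟩
  have ha' : e.extendSubtype a ∈ s := not_not.mp (e.extendSubtype_not_mem a (by simpa using ha))
  have hb' : e.extendSubtype b ∉ s := e.extendSubtype_mem b hb
  by_contra hne
  exact hb' (hc _ ha' _ (fun h => hb' (h ▸ ha')) hne)

end Irreducible

/-! ### The splitting and its Perron vectors -/

section Splitting

/-- The matrix `D - γ L` of the splitting `B = (D - γ L) - ((1 - γ) L + U)`. -/
noncomputable def splitM (B : Matrix (Fin n) (Fin n) ℝ) (γ : ℝ) : Matrix (Fin n) (Fin n) ℝ :=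
  diagPart B - γ • lowerPart B

/-- The matrix `(1 - γ) L + U` of the splitting `B = (D - γ L) - ((1 - γ) L + U)`. -/
noncomputable def splitN (B : Matrix (Fin n) (Fin n) ℝ) (γ : ℝ) : Matrix (Fin n) (Fin n) ℝ :=
  (1 - γ) • lowerPart B + upperPart B

variable {B : Matrix (Fin n) (Fin n) ℝ} {γ : ℝ}

theorem splitM_apply_self (i : Fin n) : splitM B γ i i = B i i := by
  simp [splitM, diagPart, lowerPart]

theorem splitM_apply_of_lt {i j : Fin n} (h : j < i) : splitM B γ i j = γ * B i j := by
  simp [splitM, diagPart, lowerPart, h, h.ne']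

theorem splitM_apply_of_gt {i j : Fin n} (h : i < j) : splitM B γ i j = 0 := by
  simp [splitM, diagPart, lowerPart, h.not_gt, h.ne]

theorem splitN_apply_self (i : Fin n) : splitN B γ i i = 0 := by
  simp [splitN, upperPart, lowerPart]

theorem splitN_apply_of_lt {i j : Fin n} (h : j < i) : splitN B γ i j = (1 - γ) * -B i j := by
  simp [splitN, upperPart, lowerPart, h, h.not_gt]

theorem splitN_apply_of_gt {i j : Fin n} (h : i < j) : splitN B γ i j = -B i j := by
  simp [splitN, upperPart, lowerPart, h, h.not_gt]

theorem splitM_sub_splitN : splitM B γ - splitN B γ = B := by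
  ext i j
  rw [Matrix.sub_apply]
  rcases lt_trichotomy i j with h | rfl | h
  · rw [splitM_apply_of_gt h, splitN_apply_of_gt h]; ring
  · rw [splitM_apply_self, splitN_apply_self]; ring
  · rw [splitM_apply_of_lt h, splitN_apply_of_lt h]; ring

theorem splitN_nonneg (hB : IsLMatrix B) (hγ1 : γ ≤ 1) (i j : Fin n) : 0 ≤ splitN B γ i j := by
  rcases lt_trichotomy i j with h | rfl | h
  · rw [splitN_apply_of_gt h]; linarith [hB.1 i j h.ne]
  · rw [splitN_apply_self]
  · rw [splitN_apply_of_lt h]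
    exact mul_nonneg (by linarith) (by linarith [hB.1 i j h.ne'])

theorem isUnit_det_splitM (hB : IsLMatrix B) : IsUnit (splitM B γ).det := by
  have h : (splitM B γ).det = ∏ i, splitM B γ i i :=
    Matrix.det_of_isLowerTriangular _ fun i j hij => splitM_apply_of_gt hij
  rw [h, isUnit_iff_ne_zero]
  refine Finset.prod_ne_zero_iff.mpr fun i _ => ?_
  rw [splitM_apply_self]
  exact (hB.2 i).ne'

/-- `D - γ L` is monotone. -/
theorem nonneg_of_splitM_mulVec_nonneg (hB : IsLMatrix B) (hγ0 : 0 ≤ γ) {v : Fin n → ℝ}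
    (h : ∀ i, 0 ≤ (splitM B γ *ᵥ v) i) (i : Fin n) : 0 ≤ v i := by
  -- Forward substitution: the terms left of the diagonal are nonpositive by induction.
  induction i using WellFoundedLT.induction with
  | ind i ih =>
    have h1 := h i
    simp only [mulVec, dotProduct] at h1
    rw [← Finset.add_sum_erase _ _ (Finset.mem_univ i), splitM_apply_self] at h1
    have h2 : ∑ j ∈ Finset.univ.erase i, splitM B γ i j * v j ≤ 0 := by
      refine Finset.sum_nonpos fun j hj => ?_
      rcases lt_or_gt_of_ne (Finset.ne_of_mem_erase hj) with hij | hij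
      · rw [splitM_apply_of_lt hij]
        exact mul_nonpos_of_nonpos_of_nonneg
          (mul_nonpos_of_nonneg_of_nonpos hγ0 (hB.1 i j hij.ne')) (ih j hij)
      · rw [splitM_apply_of_gt hij, zero_mul]
    exact nonneg_of_mul_nonneg_right (by linarith) (hB.2 i)

theorem splitM_inv_nonneg (hB : IsLMatrix B) (hγ0 : 0 ≤ γ) (i j : Fin n) :
    0 ≤ (splitM B γ)⁻¹ i j := by
  refine nonneg_of_splitM_mulVec_nonneg hB hγ0 (v := fun k => (splitM B γ)⁻¹ k j) (fun k => ?_) i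
  change 0 ≤ (splitM B γ * (splitM B γ)⁻¹) k j
  rw [Matrix.mul_nonsing_inv _ (isUnit_det_splitM hB), Matrix.one_apply]
  split_ifs <;> norm_num

theorem splitM_inv_mul_splitN_nonneg (hB : IsLMatrix B) (hγ0 : 0 ≤ γ) (hγ1 : γ ≤ 1)
    (i j : Fin n) : 0 ≤ ((splitM B γ)⁻¹ * splitN B γ) i j := by
  rw [Matrix.mul_apply]
  exact Finset.sum_nonneg fun k _ =>
    mul_nonneg (splitM_inv_nonneg hB hγ0 i k) (splitN_nonneg hB hγ1 k j)

theorem iterMatrix_eq (hB : IsLMatrix B) (ω : ℝ) :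
    iterMatrix B γ ω = (1 - ω) • 1 + ω • ((splitM B γ)⁻¹ * splitN B γ) := by
  have h : (1 - ω) • diagPart B + (ω - γ) • lowerPart B + ω • upperPart B =
      (1 - ω) • splitM B γ + ω • splitN B γ := by
    unfold splitM splitN
    module
  rw [iterMatrix, h, ← splitM, mul_add, mul_smul_comm, mul_smul_comm,
    Matrix.nonsing_inv_mul _ (isUnit_det_splitM hB)]

/-- Off the diagonal, `N - rM` is `-B` above and `-(1 - γ + rγ)B` below. A positive factor therefore
preserves the edges of `B`, which lets irreducibility act on eigenvectors of the pencil. -/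
theorem splitN_sub_splitM_nonneg (hB : IsLMatrix B) {r : ℝ} (hr : 0 ≤ 1 - γ + r * γ)
    {i j : Fin n} (hij : i ≠ j) : 0 ≤ splitN B γ i j - r * splitM B γ i j := by
  have h0 := hB.1 i j hij
  rcases lt_or_gt_of_ne hij with h | h
  · rw [splitM_apply_of_gt h, splitN_apply_of_gt h]; linarith
  · rw [splitM_apply_of_lt h, splitN_apply_of_lt h]
    have := mul_nonneg hr (neg_nonneg.mpr h0)
    linarith

theorem splitN_sub_splitM_ne_zero {r : ℝ} (hr : 0 < 1 - γ + r * γ)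
    {i j : Fin n} (hij : i ≠ j) (h0 : B i j ≠ 0) : splitN B γ i j - r * splitM B γ i j ≠ 0 := by
  rcases lt_or_gt_of_ne hij with h | h
  · rw [splitM_apply_of_gt h, splitN_apply_of_gt h]; simpa using h0
  · rw [splitM_apply_of_lt h, splitN_apply_of_lt h]
    have : (1 - γ) * -B i j - r * (γ * B i j) = -((1 - γ + r * γ) * B i j) := by ring
    rw [this]
    exact neg_ne_zero.mpr (mul_ne_zero hr.ne' h0)

/-- The zero set of a nonnegative right eigenvector of the pencil is closed. -/
theorem eq_zero_of_right_eigenvector (hB : IsLMatrix B) {r : ℝ} (hr : 0 < 1 - γ + r * γ)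
    {x : Fin n → ℝ} (hx : ∀ i, 0 ≤ x i) (h : splitN B γ *ᵥ x = r • (splitM B γ *ᵥ x))
    {i j : Fin n} (hij : i ≠ j) (hxi : x i = 0) (h0 : B i j ≠ 0) : x j = 0 := by
  have h1 : ∑ k, (splitN B γ i k - r * splitM B γ i k) * x k = 0 := by
    have := congrFun h i
    simp only [mulVec, dotProduct, Pi.smul_apply, smul_eq_mul] at this
    simp only [sub_mul, Finset.sum_sub_distrib, mul_assoc, ← Finset.mul_sum, this, sub_self]
  have h2 : ∀ k ∈ Finset.univ, 0 ≤ (splitN B γ i k - r * splitM B γ i k) * x k := fun k _ => by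
    rcases eq_or_ne i k with rfl | hik
    · rw [hxi, mul_zero]
    · exact mul_nonneg (splitN_sub_splitM_nonneg hB hr.le hik) (hx k)
  exact (mul_eq_zero.mp
    ((Finset.sum_eq_zero_iff_of_nonneg h2).mp h1 j (Finset.mem_univ j))).resolve_left
    (splitN_sub_splitM_ne_zero hr hij h0)

/-- The support of a nonnegative left eigenvector of the pencil is closed. -/
theorem eq_zero_of_left_eigenvector (hB : IsLMatrix B) {r : ℝ} (hr : 0 < 1 - γ + r * γ)
    {z : Fin n → ℝ} (hz : ∀ i, 0 ≤ z i) (h : z ᵥ* splitN B γ = r • (z ᵥ* splitM B γ))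
    {i j : Fin n} (hij : i ≠ j) (hzj : z j = 0) (h0 : B i j ≠ 0) : z i = 0 := by
  have h1 : ∑ k, z k * (splitN B γ k j - r * splitM B γ k j) = 0 := by
    have := congrFun h j
    simp only [vecMul, dotProduct, Pi.smul_apply, smul_eq_mul] at this
    simp only [mul_sub, Finset.sum_sub_distrib, mul_left_comm _ r, ← Finset.mul_sum, this, sub_self]
  have h2 : ∀ k ∈ Finset.univ, 0 ≤ z k * (splitN B γ k j - r * splitM B γ k j) := fun k _ => by
    rcases eq_or_ne k j with rfl | hkj
    · rw [hzj, zero_mul]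
    · exact mul_nonneg (hz k) (splitN_sub_splitM_nonneg hB hr.le hkj)
  exact (mul_eq_zero.mp
    ((Finset.sum_eq_zero_iff_of_nonneg h2).mp h1 i (Finset.mem_univ i))).resolve_right
    (splitN_sub_splitM_ne_zero hr hij h0)

theorem right_eigenvector_pos (hB : IsLMatrix B) (hirr : IsIrreducible B) {r : ℝ}
    (hr : 0 < 1 - γ + r * γ) {x : Fin n → ℝ} (hx : ∀ i, 0 ≤ x i) (hx0 : x ≠ 0)
    (h : splitN B γ *ᵥ x = r • (splitM B γ *ᵥ x)) (i : Fin n) : 0 < x i := by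
  refine lt_of_le_of_ne (hx i) fun hi => hx0 (funext fun j => ?_)
  exact hirr.mem_of_closed (s := {k | x k = 0}) ⟨i, hi.symm⟩
    (fun a ha b hab hne => eq_zero_of_right_eigenvector hB hr hx h hab ha hne) j

/-- Every row of the Gauss–Seidel iteration matrix of an irreducible L-matrix of order at least two
is nonzero. -/
theorem exists_gaussSeidel_ne_zero (hB : IsLMatrix B) (hirr : IsIrreducible B) (hn : 2 ≤ n)
    (i : Fin n) : ∃ j, ((splitM B 1)⁻¹ * splitN B 1) i j ≠ 0 := by
  by_contra! hrow
  set w : Fin n → ℝ := fun k => (splitM B 1)⁻¹ i k with hw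
  have hw0 : ∀ k, 0 ≤ w k := splitM_inv_nonneg hB zero_le_one i
  -- A vanishing sum of nonnegative terms vanishes termwise.
  have hwU : ∀ j k, j < k → w j * B j k = 0 := fun j k hjk => by
    have h1 : ∑ l, w l * splitN B 1 l k = 0 := hrow k
    have h2 := (Finset.sum_eq_zero_iff_of_nonneg fun l _ =>
      mul_nonneg (hw0 l) (splitN_nonneg hB le_rfl l k)).mp h1 j (Finset.mem_univ j)
    rw [splitN_apply_of_gt hjk] at h2
    linarith
  have hwM : ∀ k, ∑ l, w l * splitM B 1 l k = (1 : Matrix (Fin n) (Fin n) ℝ) i k := fun k => by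
    rw [← Matrix.nonsing_inv_mul _ (isUnit_det_splitM hB (γ := 1))]
    rfl
  have hone : ∀ k, 0 ≤ (1 : Matrix (Fin n) (Fin n) ℝ) i k := fun k => by
    rw [Matrix.one_apply]; split_ifs <;> norm_num
  -- The support of `w` is closed: `hwU` excludes upward edges, and a downward edge to a zero of `w`
  -- would make an entry of `wM`, a row of the identity, negative.
  have hpos : ∀ k, 0 < w k := by
    intro k
    refine hirr.mem_of_closed (s := {k | 0 < w k}) ?_ ?_ k
    · by_contra hemp
      have hz : ∀ l, w l = 0 := fun l =>
        le_antisymm (not_lt.mp fun hl => hemp ⟨l, hl⟩) (hw0 l)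
      simpa [hz] using hwM i
    · intro a ha b hab hne
      rcases lt_or_gt_of_ne hab with hlt | hlt
      · exact absurd (hwU a b hlt) (mul_ne_zero (ne_of_gt ha) hne)
      · refine lt_of_le_of_ne (hw0 b) fun hb => ?_
        have hneg : ∑ l, w l * splitM B 1 l b < 0 := by
          refine Finset.sum_neg' (fun l _ => ?_) ⟨a, Finset.mem_univ _, ?_⟩
          · rcases lt_trichotomy l b with h | rfl | h
            · rw [splitM_apply_of_gt h, mul_zero]
            · rw [← hb, zero_mul]
            · rw [splitM_apply_of_lt h, one_mul]
              exact mul_nonpos_of_nonneg_of_nonpos (hw0 l) (hB.1 l b h.ne')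
          · rw [splitM_apply_of_lt hlt, one_mul]
            exact mul_neg_of_pos_of_neg ha (lt_of_le_of_ne (hB.1 a b hlt.ne') hne)
        linarith [hwM b, hone b]
  -- With `w > 0` the upper part of `B` vanishes, so the first index has no outgoing edge.
  have h0 := hirr.mem_of_closed (s := {(⟨0, by omega⟩ : Fin n)}) ⟨_, rfl⟩
    (fun a ha b hab hne => by
      rw [Set.mem_singleton_iff] at ha
      subst ha
      have hlt : (⟨0, by omega⟩ : Fin n) < b :=
        Fin.lt_def.mpr (Nat.pos_of_ne_zero fun h => hab (Fin.ext h.symm))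
      exact absurd (hwU _ b hlt) (mul_ne_zero (hpos _).ne' hne)) ⟨1, by omega⟩
  simp at h0

/-- The Perron root of the splitting is positive for the Gauss–Seidel method. -/
theorem perron_root_gaussSeidel_pos (hB : IsLMatrix B) (hirr : IsIrreducible B) (hn : 2 ≤ n)
    {r : ℝ} (hb : IsCollatzWielandtBound ((splitM B 1)⁻¹ * splitN B 1) r) : 0 < r := by
  have : Nonempty (Fin n) := ⟨⟨0, by omega⟩⟩
  set T := (splitM B 1)⁻¹ * splitN B 1 with hT
  have hT0 : ∀ i j, 0 ≤ T i j := splitM_inv_mul_splitN_nonneg hB zero_le_one le_rfl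
  have hrow : ∀ i, 0 < (T *ᵥ fun _ => 1) i := fun i => by
    obtain ⟨j, hj⟩ := exists_gaussSeidel_ne_zero hB hirr hn i
    refine Finset.sum_pos' (fun k _ => mul_nonneg (hT0 i k) zero_le_one)
      ⟨j, Finset.mem_univ j, mul_pos (lt_of_le_of_ne (hT0 i j) hj.symm) one_pos⟩
  obtain ⟨i₀, -, hi₀⟩ := Finset.exists_min_image Finset.univ (T *ᵥ fun _ => 1)
    Finset.univ_nonempty
  refine (hrow i₀).trans_le (hb (fun _ => 1) _ (fun _ => zero_le_one) (fun h => ?_) fun i => ?_)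
  · simpa using congrFun h i₀
  · simpa using hi₀ i (Finset.mem_univ i)

theorem exists_right_perron (hB : IsLMatrix B) (hn : 0 < n) (hγ0 : 0 ≤ γ) (hγ1 : γ ≤ 1) {ω : ℝ}
    (hω0 : 0 < ω) (hω1 : ω ≤ 1) : ∃ (r : ℝ) (x : Fin n → ℝ), 0 ≤ r ∧ (∀ i, 0 ≤ x i) ∧ x ≠ 0 ∧
      splitN B γ *ᵥ x = r • (splitM B γ *ᵥ x) ∧
      IsCollatzWielandtBound ((splitM B γ)⁻¹ * splitN B γ) r ∧
      rho (iterMatrix B γ ω) = ENNReal.ofReal (1 - ω + ω * r) := by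
  have : Nonempty (Fin n) := ⟨⟨0, hn⟩⟩
  have hT := splitM_inv_mul_splitN_nonneg hB hγ0 hγ1
  obtain ⟨r, x, hr, hx, hx0, hrx, hb⟩ := exists_perron_of_nonneg hT
  refine ⟨r, x, hr, hx, hx0, ?_, hb, ?_⟩
  · rw [← mulVec_smul, ← hrx, mulVec_mulVec,
      Matrix.mul_nonsing_inv_cancel_left _ _ (isUnit_det_splitM hB)]
  · rw [iterMatrix_eq hB, rho_add_smul_eq hT hx0 hrx hb (by linarith) hω0]

theorem exists_left_perron (hB : IsLMatrix B) (hn : 0 < n) (hγ0 : 0 ≤ γ) (hγ1 : γ ≤ 1) {ω : ℝ}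
    (hω0 : 0 < ω) (hω1 : ω ≤ 1) : ∃ (r : ℝ) (z : Fin n → ℝ), 0 ≤ r ∧ (∀ i, 0 ≤ z i) ∧ z ≠ 0 ∧
      (∀ i, 0 ≤ (z ᵥ* splitM B γ) i) ∧ z ᵥ* splitM B γ ≠ 0 ∧
      z ᵥ* splitN B γ = r • (z ᵥ* splitM B γ) ∧
      rho (iterMatrix B γ ω) = ENNReal.ofReal (1 - ω + ω * r) := by
  have : Nonempty (Fin n) := ⟨⟨0, hn⟩⟩
  have hT := splitM_inv_mul_splitN_nonneg hB hγ0 hγ1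
  obtain ⟨r, y, hr, hy, hy0, hry, hb⟩ := exists_perron_of_nonneg
    (B := ((splitM B γ)⁻¹ * splitN B γ)ᵀ) fun i j => hT j i
  have hzM : (y ᵥ* (splitM B γ)⁻¹) ᵥ* splitM B γ = y := by
    rw [vecMul_vecMul, Matrix.nonsing_inv_mul _ (isUnit_det_splitM hB), vecMul_one]
  -- Taking `z = y M⁻¹` gives `zM = y` and `zN = y M⁻¹N = r y`.
  refine ⟨r, y ᵥ* (splitM B γ)⁻¹, hr, fun i => ?_, fun h => hy0 ?_, ?_, ?_, ?_, ?_⟩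
  · simp only [vecMul, dotProduct]
    exact Finset.sum_nonneg fun j _ => mul_nonneg (hy j) (splitM_inv_nonneg hB hγ0 j i)
  · rw [← hzM, h, zero_vecMul]
  · rwa [hzM]
  · rwa [hzM]
  · rw [hzM, vecMul_vecMul, ← hry, mulVec_transpose]
  · rw [← rho_transpose, iterMatrix_eq hB, transpose_add, transpose_smul, transpose_smul,
      transpose_one, rho_add_smul_eq (T := ((splitM B γ)⁻¹ * splitN B γ)ᵀ) (fun i j => hT j i)
        hy0 hry hb (by linarith) hω0]

end Splitting

end AOR

namespace AOR

open Matrix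

variable {n : ℕ}

/-! ### The preconditioned matrix and the perturbation `M' - PM` -/

section Preconditioner

variable {A : Matrix (Fin n) (Fin n) ℝ} {p : Fin n} {α : Fin n → ℝ}

theorem one_add_Q6_mul_apply_of_le (X : Matrix (Fin n) (Fin n) ℝ) {i : Fin n} (hi : i ≤ p)
    (j : Fin n) : ((1 + Q6 A p α) * X) i j = X i j := by
  rw [add_mul, one_mul, Matrix.add_apply]
  simp [Matrix.mul_apply, Q6, hi.not_gt]

theorem one_add_Q6_mul_apply_of_lt (X : Matrix (Fin n) (Fin n) ℝ) {i : Fin n} (hi : p < i)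
    (j : Fin n) : ((1 + Q6 A p α) * X) i j = X i j - α i * A i p * X p j := by
  rw [add_mul, one_mul, Matrix.add_apply]
  simp [Matrix.mul_apply, Q6, hi, sub_eq_add_neg]

theorem A6_apply_of_le {i : Fin n} (hi : i ≤ p) (j : Fin n) : A6 A p α i j = A i j :=
  one_add_Q6_mul_apply_of_le A hi j

theorem A6_apply_of_lt {i : Fin n} (hi : p < i) (j : Fin n) :
    A6 A p α i j = A i j - α i * A i p * A p j :=
  one_add_Q6_mul_apply_of_lt A hi j

theorem splitM_A6_sub_apply_of_le {γ : ℝ} {i : Fin n} (hi : i ≤ p) (j : Fin n) :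
    (splitM (A6 A p α) γ - (1 + Q6 A p α) * splitM A γ) i j = 0 := by
  rw [Matrix.sub_apply, one_add_Q6_mul_apply_of_le _ hi]
  rcases lt_trichotomy i j with h | rfl | h
  · rw [splitM_apply_of_gt h, splitM_apply_of_gt h, sub_self]
  · rw [splitM_apply_self, splitM_apply_self, A6_apply_of_le hi, sub_self]
  · rw [splitM_apply_of_lt h, splitM_apply_of_lt h, A6_apply_of_le hi, sub_self]

theorem splitM_A6_sub_apply_col (hdiag : ∀ i, A i i = 1) {γ : ℝ} {i : Fin n} (hi : p < i) :
    (splitM (A6 A p α) γ - (1 + Q6 A p α) * splitM A γ) i p = (1 - γ) * (α i * A i p) := by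
  rw [Matrix.sub_apply, one_add_Q6_mul_apply_of_lt _ hi, splitM_apply_of_lt hi,
    splitM_apply_of_lt hi, splitM_apply_self, A6_apply_of_lt hi, hdiag]
  ring

theorem splitM_A6_sub_apply_self {γ : ℝ} {i : Fin n} (hi : p < i) :
    (splitM (A6 A p α) γ - (1 + Q6 A p α) * splitM A γ) i i = -(α i * A i p * A p i) := by
  rw [Matrix.sub_apply, one_add_Q6_mul_apply_of_lt _ hi, splitM_apply_self,
    splitM_apply_self, splitM_apply_of_gt hi, A6_apply_of_lt hi]
  ring

theorem splitM_A6_sub_apply_of_lt_of_lt {γ : ℝ} {i j : Fin n} (hj : p < j) (hji : j < i) :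
    (splitM (A6 A p α) γ - (1 + Q6 A p α) * splitM A γ) i j = -(γ * (α i * A i p * A p j)) := by
  have hi := hj.trans hji
  rw [Matrix.sub_apply, one_add_Q6_mul_apply_of_lt _ hi, splitM_apply_of_lt hji,
    splitM_apply_of_lt hji, splitM_apply_of_gt hj, A6_apply_of_lt hi]
  ring

variable (hdiag : ∀ i, A i i = 1) (hL : IsLMatrix A) (hα : ∀ k, p < k → 0 ≤ α k)
include hL hα

theorem mul_apply_nonpos {i : Fin n} (hi : p < i) : α i * A i p ≤ 0 :=
  mul_nonpos_of_nonneg_of_nonpos (hα i hi) (hL.1 i p hi.ne')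

theorem mul_mul_apply_nonneg {i j : Fin n} (hi : p < i) (hj : p ≠ j) :
    0 ≤ α i * A i p * A p j :=
  mul_nonneg_of_nonpos_of_nonpos (mul_apply_nonpos hL hα hi) (hL.1 p j hj)

/-- Preconditioning subtracts nonnegative products outside column `p`, so no edge ending elsewhere
than `p` is lost. -/
theorem A6_le {i j : Fin n} (hj : p ≠ j) : A6 A p α i j ≤ A i j := by
  rcases le_or_gt i p with hi | hi
  · rw [A6_apply_of_le hi]
  · rw [A6_apply_of_lt hi]
    linarith [mul_mul_apply_nonneg hL hα hi hj]

theorem A6_ne_zero {i j : Fin n} (hj : p ≠ j) (hij : i ≠ j) (h : A i j ≠ 0) :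
    A6 A p α i j ≠ 0 :=
  ((A6_le hL hα hj).trans_lt (lt_of_le_of_ne (hL.1 i j hij) h)).ne

include hdiag

theorem isLMatrix_A6 (hα1 : ∀ k, p < k → α k ≤ 1)
    (hlt : ∀ k, p < k → α k * A k p * A p k < 1) : IsLMatrix (A6 A p α) := by
  constructor
  · intro i j hij
    rcases eq_or_ne p j with rfl | hj
    · rcases le_or_gt i p with hi | hi
      · rw [A6_apply_of_le hi]
        exact hL.1 i p hij
      · rw [A6_apply_of_lt hi, hdiag]
        nlinarith [hL.1 i p hij, hα1 i hi]
    · exact (A6_le hL hα hj).trans (hL.1 i j hij)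
  · intro i
    rcases le_or_gt i p with hi | hi
    · rw [A6_apply_of_le hi]
      exact hL.2 i
    · rw [A6_apply_of_lt hi, hdiag]
      linarith [hlt i hi]

/-- If all `α k < 1`, the preconditioned matrix has all off-diagonal edges of `A`. -/
theorem A6_ne_zero_of_lt_one (hα1 : ∀ k, p < k → α k < 1) {i j : Fin n} (hij : i ≠ j)
    (h : A i j ≠ 0) : A6 A p α i j ≠ 0 := by
  rcases eq_or_ne p j with rfl | hj
  · rcases le_or_gt i p with hi | hi
    · rwa [A6_apply_of_le hi]
    · rw [A6_apply_of_lt hi, hdiag]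
      have : A i p - α i * A i p * 1 = (1 - α i) * A i p := by ring
      rw [this]
      exact mul_ne_zero (by linarith [hα1 i hi]) h
  · exact A6_ne_zero hL hα hj hij h

/-- A nonempty set closed under the edges of the preconditioned matrix contains all indices,
provided that `0 ≤ α ≲ 1`. -/
theorem mem_of_closed_A6_of_lesssimOne (hirr : IsIrreducible A) (h : LesssimOne A p α)
    {s : Set (Fin n)} (hs : s.Nonempty)
    (hc : ∀ i ∈ s, ∀ j, i ≠ j → A6 A p α i j ≠ 0 → j ∈ s) (j : Fin n) : j ∈ s := by
  by_cases hirr6 : IsIrreducible (A6 A p α)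
  · exact hirr6.mem_of_closed hs hc j
  · have hα1 : ∀ k, p < k → α k < 1 := fun k hk =>
      (h k hk).2.resolve_right fun h' => hirr6 h'.2
    exact hirr.mem_of_closed hs
      (fun a ha b hab hne => hc a ha b hab (A6_ne_zero_of_lt_one hdiag hL hα hα1 hab hne)) j

omit hdiag in
/-- A nonempty set closed under the edges of the preconditioned matrix contains all `j > p`,
provided that `p` is the first index and all `α k` are positive. -/
theorem mem_of_closed_A6_of_pos (hirr : IsIrreducible A) (hp0 : (p : ℕ) = 0)
    (hpos : ∀ k, p < k → 0 < α k) {s : Set (Fin n)} (hs : s.Nonempty)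
    (hc : ∀ i ∈ s, ∀ j, i ≠ j → A6 A p α i j ≠ 0 → j ∈ s) (j : Fin n) (hj : p < j) : j ∈ s := by
  have hlt : ∀ k, k ≠ p → p < k := fun k hk =>
    Fin.lt_def.mpr (by have : (k : ℕ) ≠ p := fun h => hk (Fin.ext h); omega)
  have hedge : ∀ i ∈ s, ∀ k, k ≠ p → i ≠ k → A i k ≠ 0 → k ∈ s := fun i hi k hk hik hne =>
    hc i hi k hik (A6_ne_zero hL hα hk.symm hik hne)
  -- An edge `i → p` may disappear when `α i = 1`, but the path `i → p → k` then survives as fill-in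
  -- `i → k`. If no edge of `A` leads from `s` to `p`, then `s` is closed for `A` itself, which
  -- forces `p ∈ s`.
  have hfrom : ∀ k, k ≠ p → A p k ≠ 0 → k ∈ s := by
    intro k hk hne
    by_cases hps : p ∈ s
    · exact hedge p hps k hk hk.symm hne
    by_cases hto : ∃ i ∈ s, A i p ≠ 0
    · obtain ⟨i, hi, hip⟩ := hto
      rcases eq_or_ne i k with rfl | hik
      · exact hi
      have hpi : p < i := hlt i fun h => hps (h ▸ hi)
      refine hc i hi k hik (ne_of_lt ?_)
      rw [A6_apply_of_lt hpi]
      have h1 : 0 < α i * A i p * A p k := by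
        refine lt_of_le_of_ne (mul_mul_apply_nonneg hL hα hpi hk.symm) (Ne.symm ?_)
        exact mul_ne_zero (mul_ne_zero (hpos i hpi).ne' hip) hne
      linarith [hL.1 i k hik]
    · push Not at hto
      refine absurd (hirr.mem_of_closed hs (fun a ha b hab hne' => ?_) p) hps
      rcases eq_or_ne b p with rfl | hb
      · exact absurd (hto a ha) hne'
      · exact hedge a ha b hb hab hne'
  have := hirr.mem_of_closed (s := s ∪ {p}) (hs.mono Set.subset_union_left)
    (fun a ha b hab hne => ?_) j
  · exact this.resolve_right hj.ne'
  · rcases eq_or_ne b p with rfl | hb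
    · exact Or.inr rfl
    · rcases ha with ha | rfl
      · exact Or.inl (hedge a ha b hb hab hne)
      · exact Or.inl (hfrom b hb hne)

/-- In a row `i > p` the perturbation is supported in columns `p` to `i`; elsewhere the
contributions cancel or vanish. -/
theorem splitM_A6_sub_nonpos {γ : ℝ} (hγ0 : 0 ≤ γ) (hγ1 : γ ≤ 1) (i j : Fin n) :
    (splitM (A6 A p α) γ - (1 + Q6 A p α) * splitM A γ) i j ≤ 0 := by
  rcases le_or_gt i p with hi | hi
  · rw [splitM_A6_sub_apply_of_le hi]
  rcases lt_trichotomy j p with hj | rfl | hj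
  · have hji := hj.trans hi
    rw [Matrix.sub_apply, one_add_Q6_mul_apply_of_lt _ hi, splitM_apply_of_lt hji,
      splitM_apply_of_lt hji, splitM_apply_of_lt hj, A6_apply_of_lt hi]
    exact le_of_eq (by ring)
  · rw [splitM_A6_sub_apply_col hdiag hi]
    exact mul_nonpos_of_nonneg_of_nonpos (by linarith) (mul_apply_nonpos hL hα hi)
  rcases lt_trichotomy j i with hji | rfl | hji
  · rw [splitM_A6_sub_apply_of_lt_of_lt hj hji]
    exact neg_nonpos.mpr (mul_nonneg hγ0 (mul_mul_apply_nonneg hL hα hi hj.ne))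
  · rw [splitM_A6_sub_apply_self hi]
    exact neg_nonpos.mpr (mul_mul_apply_nonneg hL hα hi hj.ne)
  · rw [Matrix.sub_apply, one_add_Q6_mul_apply_of_lt _ hi, splitM_apply_of_gt hji,
      splitM_apply_of_gt hji, splitM_apply_of_gt hj]
    simp

/-- The perturbation `M₆ - (I + Q₆) M` is nonzero below row `p`. -/
theorem exists_splitM_A6_sub_neg {γ : ℝ} (hγ0 : 0 ≤ γ) (hγ1 : γ ≤ 1)
    (hQ : ∃ k, p < k ∧ α k * A k p ≠ 0)
    (h : γ = 1 → ∃ i j, p < j ∧ j ≤ i ∧ 0 < α i * A i p * A p j) :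
    ∃ i j, p < i ∧ (splitM (A6 A p α) γ - (1 + Q6 A p α) * splitM A γ) i j < 0 := by
  rcases hγ1.lt_or_eq with hγ | rfl
  · obtain ⟨k, hk, hne⟩ := hQ
    refine ⟨k, p, hk, ?_⟩
    rw [splitM_A6_sub_apply_col hdiag hk]
    exact mul_neg_of_pos_of_neg (by linarith) (lt_of_le_of_ne (mul_apply_nonpos hL hα hk) hne)
  · obtain ⟨i, j, hj, hji, hpos⟩ := h rfl
    refine ⟨i, j, hj.trans_le hji, ?_⟩
    rcases hji.lt_or_eq with hji | rfl
    · rw [splitM_A6_sub_apply_of_lt_of_lt hj hji]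
      linarith
    · rw [splitM_A6_sub_apply_self hj]
      linarith

end Preconditioner

/-! ### Comparison of the two Perron roots -/

theorem eigenvalue_sub_mul_eq {A A' P : Matrix (Fin n) (Fin n) ℝ} (hA' : A' = P * A)
    {γ r r' : ℝ} {x z : Fin n → ℝ} (hx : splitN A γ *ᵥ x = r • (splitM A γ *ᵥ x))
    (hz : z ᵥ* splitN A' γ = r' • (z ᵥ* splitM A' γ)) :
    (r' - r) * ((z ᵥ* splitM A' γ) ⬝ᵥ x) =
      (1 - r) * (z ⬝ᵥ ((splitM A' γ - P * splitM A γ) *ᵥ x)) := by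
  have h1 : z ⬝ᵥ (A' *ᵥ x) = (1 - r') * ((z ᵥ* splitM A' γ) ⬝ᵥ x) := by
    conv_lhs => rw [← splitM_sub_splitN (B := A') (γ := γ)]
    rw [dotProduct_mulVec, vecMul_sub, hz, sub_dotProduct, smul_dotProduct, smul_eq_mul]
    ring
  have h2 : A *ᵥ x = (1 - r) • (splitM A γ *ᵥ x) := by
    conv_lhs => rw [← splitM_sub_splitN (B := A) (γ := γ)]
    rw [sub_mulVec, hx]
    module
  have h3 : z ⬝ᵥ (A' *ᵥ x) = (1 - r) * (z ⬝ᵥ ((P * splitM A γ) *ᵥ x)) := by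
    rw [hA', ← mulVec_mulVec, h2, mulVec_smul, dotProduct_smul, mulVec_mulVec, smul_eq_mul]
  rw [sub_mulVec, dotProduct_sub, dotProduct_mulVec z (splitM A' γ)]
  linarith

/-- The map `r ↦ 1 - ω + ωr` is strictly increasing, fixes `1` and is nonnegative for `r ≥ 0`, so
`ENNReal.ofReal` truncates nothing. -/
theorem steinRosenbergII_of_trichotomy {B A : Matrix (Fin n) (Fin n) ℝ} {γ ω r r' : ℝ}
    (hω0 : 0 < ω) (hω1 : ω ≤ 1) (hr : 0 ≤ r) (hr' : 0 ≤ r')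
    (hA : rho (iterMatrix A γ ω) = ENNReal.ofReal (1 - ω + ω * r))
    (hB : rho (iterMatrix B γ ω) = ENNReal.ofReal (1 - ω + ω * r'))
    (hlt : r < 1 → r' < r) (heq : r = 1 → r' = r) (hgt : 1 < r → r < r') :
    SteinRosenbergII B A γ ω := by
  have h0 : 0 ≤ ω * r := mul_nonneg hω0.le hr
  have h0' : 0 ≤ ω * r' := mul_nonneg hω0.le hr'
  refine ⟨?_, fun h => h.1.1.ne h.2.1, fun h => h.1.1.not_gt h.2.1, fun h => h.2.1.ne' h.1.1⟩
  rw [hA, hB, ← ENNReal.ofReal_one, gt_iff_lt, gt_iff_lt]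
  rcases lt_trichotomy r 1 with h | h | h
  · have h1 := mul_lt_mul_of_pos_left h hω0
    have h2 := mul_lt_mul_of_pos_left (hlt h) hω0
    exact Or.inl ⟨(ENNReal.ofReal_lt_ofReal_iff_of_nonneg (by linarith)).mpr (by linarith),
      (ENNReal.ofReal_lt_ofReal_iff_of_nonneg (by linarith)).mpr (by linarith)⟩
  · refine Or.inr (Or.inl ⟨by rw [heq h], ?_⟩)
    rw [h]
    congr 1
    ring
  · have h1 := mul_lt_mul_of_pos_left h hω0
    have h2 := mul_lt_mul_of_pos_left (hgt h) hω0
    exact Or.inr (Or.inr ⟨(ENNReal.ofReal_lt_ofReal_iff_of_nonneg (by linarith)).mpr (by linarith),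
      (ENNReal.ofReal_lt_ofReal_iff_of_nonneg (by linarith)).mpr (by linarith)⟩)

/-- The comparison theorem, with the conditions on the preconditioner reduced to a connectivity
property of the preconditioned matrix and the existence of a positive product in the
Gauss–Seidel case. -/
theorem steinRosenbergII_A6 {A : Matrix (Fin n) (Fin n) ℝ} (hdiag : ∀ i, A i i = 1)
    (hL : IsLMatrix A) (hirr : IsIrreducible A) {p : Fin n} (hn : 2 ≤ n) {α : Fin n → ℝ}
    (hα : ∀ k, p < k → 0 ≤ α k) (hα1 : ∀ k, p < k → α k ≤ 1)
    (hQ : ∃ k, p < k ∧ α k * A k p ≠ 0)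
    (hlt : ∀ k, p < k → α k * A k p * A p k < 1)
    {γ ω : ℝ} (hω0 : 0 < ω) (hω1 : ω ≤ 1) (hγ0 : 0 ≤ γ) (hγ1 : γ ≤ 1)
    (hconn : ∀ s : Set (Fin n), s.Nonempty →
      (∀ i ∈ s, ∀ j, i ≠ j → A6 A p α i j ≠ 0 → j ∈ s) → ∀ j, p < j → j ∈ s)
    (hprod : γ = 1 → ∃ i j, p < j ∧ j ≤ i ∧ 0 < α i * A i p * A p j) :
    SteinRosenbergII (A6 A p α) A γ ω := by
  have hL6 := isLMatrix_A6 hdiag hL hα hα1 hlt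
  obtain ⟨r, x, hr, hx, hx0, hrx, hb, hA⟩ :=
    exists_right_perron hL (by omega) hγ0 hγ1 hω0 hω1
  obtain ⟨r', z, hr', hz, hz0, hy, hy0, hrz, hA'⟩ :=
    exists_left_perron hL6 (by omega) hγ0 hγ1 hω0 hω1
  have hpencil : 0 < 1 - γ + r * γ := by
    rcases hγ1.lt_or_eq with h | rfl
    · have := mul_nonneg hr hγ0
      linarith
    · have := perron_root_gaussSeidel_pos hL hirr hn hb
      linarith
  have hxpos := right_eigenvector_pos hL hirr hpencil hx hx0 hrx
  have key := eigenvalue_sub_mul_eq (A' := A6 A p α) (P := 1 + Q6 A p α) rfl hrx hrz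
  set y := z ᵥ* splitM (A6 A p α) γ with hydef
  set E := splitM (A6 A p α) γ - (1 + Q6 A p α) * splitM A γ with hE
  have hE0 : ∀ i j, E i j ≤ 0 := splitM_A6_sub_nonpos hdiag hL hα hγ0 hγ1
  have hyx : 0 < y ⬝ᵥ x := by
    obtain ⟨i, hi⟩ := Function.ne_iff.mp hy0
    exact Finset.sum_pos' (fun j _ => mul_nonneg (hy j) (hx j))
      ⟨i, Finset.mem_univ i, mul_pos (lt_of_le_of_ne (hy i) (Ne.symm hi)) (hxpos i)⟩
  have hEx : ∀ i, (E *ᵥ x) i ≤ 0 := fun i => by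
    simp only [mulVec, dotProduct]
    exact Finset.sum_nonpos fun j _ => mul_nonpos_of_nonpos_of_nonneg (hE0 i j) (hx j)
  have hle : z ⬝ᵥ (E *ᵥ x) ≤ 0 :=
    Finset.sum_nonpos fun i _ => mul_nonpos_of_nonneg_of_nonpos (hz i) (hEx i)
  have hneg : 0 < 1 - γ + r' * γ → z ⬝ᵥ (E *ᵥ x) < 0 := by
    intro hpencil'
    have hzpos : ∀ j, p < j → 0 < z j := by
      refine hconn {k | 0 < z k} ?_ fun i hi j hij hne => ?_
      · obtain ⟨i, hi⟩ := Function.ne_iff.mp hz0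
        exact ⟨i, lt_of_le_of_ne (hz i) (Ne.symm hi)⟩
      · refine lt_of_le_of_ne (hz j) fun hj => ?_
        exact (ne_of_gt hi) (eq_zero_of_left_eigenvector hL6 hpencil' hz hrz hij hj.symm hne)
    obtain ⟨i, j, hi, hij⟩ := exists_splitM_A6_sub_neg hdiag hL hα hγ0 hγ1 hQ hprod
    refine Finset.sum_neg' (fun i _ => mul_nonpos_of_nonneg_of_nonpos (hz i) (hEx i))
      ⟨i, Finset.mem_univ i, mul_neg_of_pos_of_neg (hzpos i hi) ?_⟩
    exact Finset.sum_neg' (fun j _ => mul_nonpos_of_nonpos_of_nonneg (hE0 i j) (hx j))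
      ⟨j, Finset.mem_univ j, mul_neg_of_neg_of_pos hij (hxpos j)⟩
  -- The second alternative gives `r' < r` outright; for `r > 1` it contradicts `r ≤ r'`, which
  -- follows from `zEx ≤ 0` alone.
  have hpencil_or : 0 < 1 - γ + r' * γ ∨ (r' = 0 ∧ 0 < r) := by
    rcases hγ1.lt_or_eq with h | rfl
    · have := mul_nonneg hr' hγ0
      exact Or.inl (by linarith)
    · rcases hr'.lt_or_eq with h | h
      · exact Or.inl (by linarith)
      · exact Or.inr ⟨h.symm, perron_root_gaussSeidel_pos hL hirr hn hb⟩
  refine steinRosenbergII_of_trichotomy hω0 hω1 hr hr' hA hA' (fun h => ?_) (fun h => ?_)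
    fun h => ?_
  · rcases hpencil_or with hp | ⟨h0, hpos⟩
    · have := mul_neg_of_pos_of_neg (sub_pos.mpr h) (hneg hp)
      rw [← key] at this
      linarith [neg_of_mul_neg_left this hyx.le]
    · rwa [h0]
  · rw [h, sub_self, zero_mul, ← h] at key
    exact sub_eq_zero.mp ((mul_eq_zero.mp key).resolve_right hyx.ne')
  · have hge : 0 ≤ r' - r := by
      have := mul_nonneg_of_nonpos_of_nonpos (sub_nonpos.mpr h.le) hle
      rw [← key] at this
      exact nonneg_of_mul_nonneg_left this hyx
    rcases hpencil_or with hp | ⟨h0, hpos⟩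
    · have := mul_pos_of_neg_of_neg (sub_neg.mpr h) (hneg hp)
      rw [← key] at this
      linarith [pos_of_mul_pos_left this hyx.le]
    · linarith

/-- Every row of an irreducible L-matrix of order at least two has a negative off-diagonal entry. -/
theorem IsIrreducible.exists_apply_neg {A : Matrix (Fin n) (Fin n) ℝ} (hirr : IsIrreducible A)
    (hL : IsLMatrix A) {p q : Fin n} (hpq : p ≠ q) : ∃ j, p ≠ j ∧ A p j < 0 := by
  by_contra! h
  refine hpq (hirr.mem_of_closed (s := {p}) ⟨p, rfl⟩ (fun a ha b hab hne => ?_) q).symm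
  rw [Set.mem_singleton_iff] at ha
  subst ha
  exact absurd (le_antisymm (hL.1 a b hab) (h b hab)) hne

theorem exists_pos_product {A : Matrix (Fin n) (Fin n) ℝ} (hL : IsLMatrix A)
    (hirr : IsIrreducible A) {p : Fin n} (hp : (p : ℕ) + 1 < n) {α : Fin n → ℝ}
    (hα : ∀ k, p < k → 0 ≤ α k) (hQ : ∃ k, p < k ∧ α k * A k p ≠ 0)
    (h : (∃ i j, p < j ∧ j ≤ i ∧ 0 < α i * A i p * A p j) ∨ A p ⟨p + 1, hp⟩ < 0 ∨
      ((p : ℕ) = 0 ∧ A ⟨n - 1, by omega⟩ p < 0 ∧ 0 < α ⟨n - 1, by omega⟩)) :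
    ∃ i j, p < j ∧ j ≤ i ∧ 0 < α i * A i p * A p j := by
  rcases h with h | h | ⟨hp0, hneg, hpos⟩
  · exact h
  · obtain ⟨k, hk, hne⟩ := hQ
    refine ⟨k, ⟨p + 1, hp⟩, Fin.lt_def.mpr (Nat.lt_succ_self _), Fin.le_def.mpr hk, ?_⟩
    exact mul_pos_of_neg_of_neg (lt_of_le_of_ne (mul_apply_nonpos hL hα hk) hne) h
  -- As `p` is the first index and `i` the last, any negative off-diagonal entry of row `p` has `p <
  -- j ≤ i`.
  · obtain ⟨j, hj, hjneg⟩ := hirr.exists_apply_neg hL (p := p) (q := ⟨p + 1, hp⟩)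
      (Fin.ne_of_val_ne (by simp))
    have hjv : (j : ℕ) ≠ p := fun h => hj (Fin.ext h.symm)
    refine ⟨⟨n - 1, by omega⟩, j, Fin.lt_def.mpr (by omega), Fin.le_def.mpr (by simp; omega), ?_⟩
    exact mul_pos_of_neg_of_neg (mul_neg_of_pos_of_neg hpos hneg) hjneg

end AOR

/-- With `0`-based indices, `p` is the column `r - 1` of the `1`-based notation, so that `r = p + 2`,
`2 ≤ r ≤ n` reads `p + 1 < n`, and `k ∈ {r, …, n}` reads `p < k`. -/
theorem theorem3p23 {n : ℕ} (A : Matrix (Fin n) (Fin n) ℝ)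
    (hdiag : ∀ i, A i i = 1) (hL : AOR.IsLMatrix A) (hirr : AOR.IsIrreducible A)
    (p : Fin n) (hp : (p : ℕ) + 1 < n)
    (α : Fin n → ℝ) (hα : ∀ k, p < k → 0 ≤ α k)
    (hQ : ∑ k ∈ Finset.Ioi p, α k * A k p ≠ 0)
    (hlt : ∀ k, p < k → α k * A k p * A p k < 1)
    (γ ω : ℝ) (hω0 : 0 < ω) (hω1 : ω ≤ 1) (hγ0 : 0 ≤ γ) (hγ1 : γ ≤ 1)
    (hcond :
      -- (i)
      (γ < 1 ∧ AOR.LesssimOne A p α) ∨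
      -- (ii)
      (γ = 1 ∧ AOR.LesssimOne A p α ∧
        ((∃ i j, p < j ∧ j ≤ i ∧ 0 < α i * A i p * A p j) ∨
          A p ⟨p + 1, hp⟩ < 0 ∨
          ((p : ℕ) = 0 ∧ A ⟨n - 1, by omega⟩ p < 0 ∧ 0 < α ⟨n - 1, by omega⟩))) ∨
      -- (iii)
      ((p : ℕ) = 0 ∧ γ < 1 ∧ ∀ k, p < k → 0 < α k ∧ α k ≤ 1) ∨
      -- (iv)
      ((p : ℕ) = 0 ∧ γ = 1 ∧ (∀ k, p < k → 0 < α k ∧ α k ≤ 1) ∧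
        ((∃ i j, p < j ∧ j ≤ i ∧ 0 < A i p * A p j) ∨
          A p ⟨p + 1, hp⟩ < 0 ∨
          A ⟨n - 1, by omega⟩ p < 0))) :
    AOR.SteinRosenbergII (AOR.A6 A p α) A γ ω := by

  have hQ' : ∃ k, p < k ∧ α k * A k p ≠ 0 := by
    obtain ⟨k, hk, hne⟩ := Finset.exists_ne_zero_of_sum_ne_zero hQ
    exact ⟨k, Finset.mem_Ioi.mp hk, hne⟩
  have main := fun hα1 => AOR.steinRosenbergII_A6 hdiag hL hirr (by omega) hα hα1 hQ' hlt
    hω0 hω1 hγ0 hγ1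
  have hle : AOR.LesssimOne A p α → ∀ k, p < k → α k ≤ 1 := fun h k hk =>
    (h k hk).2.elim le_of_lt And.left
  have hconn := fun (h : AOR.LesssimOne A p α) (s : Set (Fin n)) hs hc (j : Fin n) (_ : p < j) =>
    AOR.mem_of_closed_A6_of_lesssimOne hdiag hL hα hirr h (s := s) hs hc j
  have hconn' := fun (hp0 : (p : ℕ) = 0) (h : ∀ k, p < k → 0 < α k ∧ α k ≤ 1)
    (s : Set (Fin n)) hs hc =>
    AOR.mem_of_closed_A6_of_pos hL hα hirr hp0 (fun k hk => (h k hk).1) (s := s) hs hc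
  rcases hcond with ⟨hγ, h⟩ | ⟨-, h, hprod⟩ | ⟨hp0, hγ, h⟩ | ⟨hp0, -, h, hprod⟩
  · exact main (hle h) (hconn h) fun h1 => absurd h1 hγ.ne
  · exact main (hle h) (hconn h) fun _ => AOR.exists_pos_product hL hirr hp hα hQ' hprod
  · exact main (fun k hk => (h k hk).2) (hconn' hp0 h) fun h1 => absurd h1 hγ.ne
  · refine main (fun k hk => (h k hk).2) (hconn' hp0 h) fun _ =>
      AOR.exists_pos_product hL hirr hp hα hQ' ?_
    refine hprod.imp ?_ (Or.imp id fun hneg => ⟨hp0, hneg, (h _ ?_).1⟩)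
    · rintro ⟨i, j, hj, hji, hpos⟩
      refine ⟨i, j, hj, hji, ?_⟩
      rw [mul_assoc]
      exact mul_pos (h i (hj.trans_le hji)).1 hpos
    · exact Fin.lt_def.mpr (by simp; omega)
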